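/- All rings are commutative with identity, and a local ring is a Noetherian ring with exactly one maximal ideal. Let $(T,M)$ be a complete local ring (complete in the $M$-adic topology) with $\dim T\ge 1$. Let $S\subseteq T$ be a subring which is a countable local domain with maximal ideal $S\cap M$, and suppose that $\widehat S=T$, that is, the completion of $S$ with respect to its maximal ideal is isomorphic to $T$ by an isomorphism which restricts to the inclusion $S\subseteq T$. Then there exists a ring $B$ with $S\subseteq B\subseteq T$ such that $B$ is an uncountable local domain with maximal ideal $B\cap M$, $\widehat B=T$ (in the same sense), and every ideal of $B$ is extended from $S$, i.e. every ideal $J$ of $B$ is of the form $J=IB$ for some ideal $I$ of $S$. -/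

import Mathlib

open IsLocalRing

/-- `T` is the completion of the local ring `R`: the `R`-algebra `T` is isomorphic, as an
`R`-algebra, to the adic completion of `R` with respect to its maximal ideal, that is, to the
inverse limit of the quotients of `R` by the powers of the maximal ideal. When `R` is a subring
of `T`, being an isomorphism of `R`-algebras means that the isomorphism restricts to the
inclusion of `R` into `T`. -/
def IsCompletionOfLocalRing (R T : Type*) [CommRing R] [IsLocalRing R] [CommRing T]
    [Algebra R T] : Prop :=
  Nonempty (AdicCompletion (maximalIdeal R) R ≃ₐ[R] T)

/-- An ideal `J` of `B` is extended from the subring `S` of `B` if `J = I B` for some ideal `I`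
of `S`. -/
def Ideal.IsExtendedFrom {T : Type*} [CommRing T] {S B : Subring T} (h : S ≤ B)
    (J : Ideal B) : Prop :=
  ∃ I : Ideal S, J = I.map (Subring.inclusion h)

/-!
Call a subring `B ⊇ S` of `T` a *unit extension* of `S` if every element of `B` is an element of `S`
times a unit of `B`. For such a `B` an ideal is generated by its elements in `S`, so every ideal is
extended from `S` (`Subring.IsUnitExtension.isExtendedFrom`). Hence `B` is Noetherian, and the
properties of `S` that matter pass to `B`: nonzero elements are regular in `T`, divisibility in `T`
between elements is divisibility in the subring, nonunits are nonunits of `T`, and the powers of the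
maximal ideal are contracted from `T`. As `S` is already dense in `T`, the completion of `B` is `T`
(`isCompletionOfLocalRing_of_dense`). For `S` itself these properties follow from the faithful
flatness of `S → Ŝ = T`.

Unit extensions are closed under unions of chains, so there is a maximal one, `B`, and it remains to
see that `B` is uncountable (`Subring.IsUnitExtension.uncountable_of_maximal`). If `B` is countable,
enumerate the nonzero polynomials over `B` and choose balls `aₙ + dₙ B`, shrinking adically, such
that the `n`-th polynomial `f` satisfies `f(aₙ₊₁) ≠ 0` and `dₙ₊₁` is a multiple of `c f(aₙ₊₁)`,
where `c ≠ 0` is a fixed element of the maximal ideal (it exists since `dim T ≥ 1`). The limit `u`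
of the `aₙ` then has `f(u) = f(aₙ₊₁) (1 + c t)`, an element of `B` times a unit of `T`
(`exists_generic`). Therefore every element of `T ∩ Frac B[u]` is an element of `B` times a unit,
and this ring is a strictly larger unit extension of `S`, contradicting maximality.
-/

/-! ### Unit extensions of a subring -/

section UnitExtension

variable {T : Type*} [CommRing T]

/-- `B` is a unit extension of the subring `S` of `T` if `B` contains `S` and every element of `B`
is the product of an element of `S` and a unit of `B`. -/
structure Subring.IsUnitExtension (S B : Subring T) : Prop where
  le : S ≤ B
  exists_eq_mul : ∀ b ∈ B, ∃ s ∈ S, ∃ v ∈ B, ∃ w ∈ B, v * w = 1 ∧ b = s * v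

namespace Subring.IsUnitExtension

variable {S B C : Subring T}

theorem refl (S : Subring T) : S.IsUnitExtension S :=
  ⟨le_rfl, fun b hb ↦ ⟨b, hb, 1, S.one_mem, 1, S.one_mem, by simp, by simp⟩⟩

theorem trans (hSB : S.IsUnitExtension B) (hBC : B.IsUnitExtension C) : S.IsUnitExtension C := by
  refine ⟨hSB.le.trans hBC.le, fun c hc ↦ ?_⟩
  obtain ⟨b, hb, v, hv, w, hw, hvw, rfl⟩ := hBC.exists_eq_mul c hc
  obtain ⟨s, hs, v', hv', w', hw', hvw', rfl⟩ := hSB.exists_eq_mul b hb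
  exact ⟨s, hs, v' * v, C.mul_mem (hBC.le hv') hv, w' * w, C.mul_mem (hBC.le hw') hw,
    by linear_combination v' * w' * hvw + hvw', by ring⟩

theorem exists_maximal (S : Subring T) : ∃ B, Maximal S.IsUnitExtension B := by
  obtain ⟨B, -, hB⟩ := zorn_le_nonempty₀ {B | S.IsUnitExtension B} (fun c hc hchain y hy ↦ by
    have hdir : DirectedOn (· ≤ ·) c := hchain.directedOn
    have mem {x : T} : x ∈ sSup c ↔ ∃ s ∈ c, x ∈ s := mem_sSup_of_directedOn ⟨y, hy⟩ hdir
    refine ⟨sSup c, ⟨(hc hy).le.trans (le_sSup hy), fun b hb ↦ ?_⟩, fun z hz ↦ le_sSup hz⟩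
    obtain ⟨C, hC, hbC⟩ := mem.1 hb
    obtain ⟨s, hs, v, hv, w, hw, h⟩ := (hc hC).exists_eq_mul b hbC
    exact ⟨s, hs, v, le_sSup hC hv, w, le_sSup hC hw, h⟩) S (refl S)
  exact ⟨B, hB⟩

theorem isExtendedFrom (h : S.IsUnitExtension B) (J : Ideal B) : J.IsExtendedFrom h.le := by
  refine ⟨J.comap (inclusion h.le), le_antisymm (fun b hb ↦ ?_) Ideal.map_comap_le⟩
  obtain ⟨s, hs, v, hv, w, hw, hvw, e⟩ := h.exists_eq_mul b b.2
  have e1 : b = inclusion h.le ⟨s, hs⟩ * ⟨v, hv⟩ := Subtype.ext e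
  have e2 : inclusion h.le ⟨s, hs⟩ = b * ⟨w, hw⟩ :=
    Subtype.ext (by change s = b * w; rw [e, mul_assoc, hvw, mul_one])
  rw [e1]
  refine Ideal.mul_mem_right _ _ (Ideal.mem_map_of_mem _ ?_)
  rw [Ideal.mem_comap, e2]
  exact J.mul_mem_right _ hb

theorem isNoetherianRing [IsNoetherianRing S] (h : S.IsUnitExtension B) : IsNoetherianRing B := by
  refine isNoetherianRing_iff_ideal_fg B |>.2 fun J ↦ ?_
  obtain ⟨I, rfl⟩ := h.isExtendedFrom J
  exact Ideal.FG.map (IsNoetherian.noetherian I) _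

theorem isLocalHom_subtype (h : S.IsUnitExtension B) (hS : IsLocalHom S.subtype) :
    IsLocalHom B.subtype := by
  refine ⟨fun b hb ↦ ?_⟩
  obtain ⟨s, hs, v, hv, w, hw, hvw, e⟩ := h.exists_eq_mul b b.2
  have e1 : b = inclusion h.le ⟨s, hs⟩ * ⟨v, hv⟩ := Subtype.ext e
  have hs' : IsUnit (S.subtype ⟨s, hs⟩) := isUnit_of_mul_isUnit_left (y := v) (by simpa [e] using hb)
  rw [e1]
  exact ((isUnit_of_map_unit _ _ hs').map _).mul
    (IsUnit.of_mul_eq_one ⟨w, hw⟩ (Subtype.ext hvw))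

/-- Regularity in `T` of the nonzero elements passes from `S` to a unit extension. -/
theorem isRegular (h : S.IsUnitExtension B) (hS : ∀ s ∈ S, s ≠ 0 → IsRegular s) :
    ∀ b ∈ B, b ≠ 0 → IsRegular b := by
  intro b hb hb0
  obtain ⟨s, hs, v, hv, w, hw, hvw, rfl⟩ := h.exists_eq_mul b hb
  exact (hS s hs (left_ne_zero_of_mul hb0)).mul (IsUnit.of_mul_eq_one w hvw).isRegular

/-- If divisibility in `T` between elements of `S` already holds in `S`, then the same is true of
a unit extension. -/
theorem exists_eq_mul_of_dvd (h : S.IsUnitExtension B)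
    (hS : ∀ a ∈ S, ∀ b ∈ S, b ∣ a → ∃ c ∈ S, a = b * c) :
    ∀ a ∈ B, ∀ b ∈ B, b ∣ a → ∃ c ∈ B, a = b * c := by
  rintro a ha b hb ⟨t, ht⟩
  obtain ⟨s, hs, v, hv, w, hw, hvw, rfl⟩ := h.exists_eq_mul a ha
  obtain ⟨s', hs', v', hv', w', hw', hvw', rfl⟩ := h.exists_eq_mul b hb
  obtain ⟨c, hc, rfl⟩ := hS s hs s' hs' ⟨v' * t * w, by linear_combination w * ht - s * hvw⟩
  exact ⟨c * v * w', B.mul_mem (B.mul_mem (h.le hc) hv) hw', by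
    linear_combination (- s' * c * v) * hvw'⟩

/-- If the powers of an ideal `I` of `S` are contracted from those of the ideal `M` of `T`, then
the powers of the contraction of `M` to a unit extension are also contracted from those of `M`. -/
theorem mem_pow_iff (h : S.IsUnitExtension B) {M : Ideal T} {I : Ideal S}
    (hI : ∀ n (s : S), (s : T) ∈ M ^ n ↔ s ∈ I ^ n) (n : ℕ) (b : B) :
    (b : T) ∈ M ^ n ↔ b ∈ M.comap B.subtype ^ n := by
  refine ⟨fun hb ↦ ?_, fun hb ↦ ?_⟩
  · obtain ⟨s, hs, v, hv, w, hw, hvw, e⟩ := h.exists_eq_mul b b.2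
    have e1 : b = inclusion h.le ⟨s, hs⟩ * ⟨v, hv⟩ := Subtype.ext e
    have e2 : s = b * w := by rw [e, mul_assoc, hvw, mul_one]
    have hsI : (⟨s, hs⟩ : S) ∈ I ^ n := (hI n _).1 (by
      change s ∈ M ^ n
      rw [e2]
      exact Ideal.mul_mem_right _ _ hb)
    have hle : I.map (inclusion h.le) ≤ M.comap B.subtype := by
      rw [Ideal.map_le_iff_le_comap]
      intro x hx
      have := (hI 1 x).2 (by simpa using hx)
      simpa using this
    rw [e1]
    refine Ideal.mul_mem_right _ _ (Ideal.pow_right_mono hle n ?_)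
    rw [← Ideal.map_pow]
    exact Ideal.mem_map_of_mem _ hsI
  · exact Ideal.le_comap_pow B.subtype n hb

end Subring.IsUnitExtension

end UnitExtension

/-! ### Completions of local rings -/

section Completion

/-- A local ring `R` whose powers of the maximal ideal are contracted from those of `M`, and which
is dense in the `M`-adically complete ring `T`, has completion `T`. -/
theorem isCompletionOfLocalRing_of_dense {R T : Type*} [CommRing R] [IsLocalRing R] [CommRing T]
    [Algebra R T] (M : Ideal T) [IsAdicComplete M T]
    (hmem : ∀ n (r : R), algebraMap R T r ∈ M ^ n ↔ r ∈ maximalIdeal R ^ n)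
    (hdense : ∀ n (t : T), ∃ r : R, t - algebraMap R T r ∈ M ^ n) :
    IsCompletionOfLocalRing R T := by
  set I := maximalIdeal R
  let q (n : ℕ) : R ⧸ I ^ n →ₐ[R] T ⧸ M ^ n :=
    Ideal.Quotient.liftₐ (I ^ n) (Algebra.ofId R (T ⧸ M ^ n)) fun r hr ↦
      Ideal.Quotient.eq_zero_iff_mem.2 ((hmem n r).2 hr)
  have hq (n : ℕ) (r : R) : q n (Ideal.Quotient.mk _ r) = Ideal.Quotient.mk _ (algebraMap R T r) :=
    rfl
  have hcompat {m n : ℕ} (hle : m ≤ n) :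
      (Ideal.Quotient.factorₐ R (Ideal.pow_le_pow_right hle)).comp
        ((q n).comp (AdicCompletion.evalₐ I n)) = (q m).comp (AdicCompletion.evalₐ I m) := by
    ext x
    induction x using AdicCompletion.induction_on with
    | h f =>
      simp only [AlgHom.comp_apply, AdicCompletion.evalₐ_mk, hq]
      change Ideal.Quotient.mk _ (algebraMap R T (f n)) = _
      have := AdicCompletion.Ideal.mk_eq_mk (I := I) hle f
      rw [← hq, this]
      rfl
  let F : AdicCompletion I R →ₐ[R] T :=
    IsAdicComplete.liftAlgHom M (fun n ↦ (q n).comp (AdicCompletion.evalₐ I n)) hcompat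
  have hF (n : ℕ) (x : AdicCompletion I R) :
      Ideal.Quotient.mk (M ^ n) (F x) = q n (AdicCompletion.evalₐ I n x) :=
    IsAdicComplete.mk_liftAlgHom M _ hcompat n x
  have hqinj (n : ℕ) : Function.Injective (q n) := by
    rw [injective_iff_map_eq_zero]
    intro a ha
    obtain ⟨r, rfl⟩ := Ideal.Quotient.mk_surjective a
    rw [hq, Ideal.Quotient.eq_zero_iff_mem, hmem] at ha
    exact Ideal.Quotient.eq_zero_iff_mem.2 ha
  refine ⟨AlgEquiv.ofBijective F ⟨?_, fun t ↦ ?_⟩⟩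
  · rw [injective_iff_map_eq_zero]
    intro x hx
    refine AdicCompletion.ext_evalₐ fun n ↦ hqinj n ?_
    rw [← hF, hx]
    simp
  · choose r hr using fun n ↦ hdense n t
    let f : AdicCompletion.AdicCauchySequence I R := AdicCompletion.AdicCauchySequence.mk I R r (by
      intro n
      rw [SModEq.sub_mem, smul_eq_mul, Ideal.mul_top, ← hmem, map_sub]
      have h1 := Ideal.sub_mem _ (Ideal.pow_le_pow_right n.le_succ (hr (n + 1))) (hr n)
      simpa using h1)
    refine ⟨AdicCompletion.mk I R f, ?_⟩
    refine (IsHausdorff.eq_iff_smodEq (I := M)).2 fun n ↦ ?_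
    rw [smul_eq_mul, Ideal.mul_top]
    refine Ideal.Quotient.eq.1 ?_ |> SModEq.sub_mem.2
    rw [hF, AdicCompletion.evalₐ_mk, hq, eq_comm, Ideal.Quotient.eq]
    exact hr n

variable {R T : Type*} [CommRing R] [IsLocalRing R] [IsNoetherianRing R] [CommRing T]
  [Algebra R T]

theorem IsCompletionOfLocalRing.flat (h : IsCompletionOfLocalRing R T) : Module.Flat R T :=
  let ⟨e⟩ := h
  Module.Flat.of_linearEquiv e.symm.toLinearEquiv

theorem IsCompletionOfLocalRing.maximalIdeal_eq_map [IsLocalRing T]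
    (h : IsCompletionOfLocalRing R T) :
    maximalIdeal T = (maximalIdeal R).map (algebraMap R T) := by
  obtain ⟨e⟩ := h
  rw [← map_maximalIdeal_of_surjective e.toAlgHom.toRingHom e.surjective,
    AdicCompletion.maximalIdeal_eq_map, Ideal.map_map]
  exact congrArg (Ideal.map · _) e.toAlgHom.comp_algebraMap

theorem IsCompletionOfLocalRing.dense [IsLocalRing T]
    (h : IsCompletionOfLocalRing R T) (n : ℕ) (t : T) :
    ∃ r : R, t - algebraMap R T r ∈ maximalIdeal T ^ n := by
  rw [h.maximalIdeal_eq_map]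
  obtain ⟨e⟩ := h
  obtain ⟨x, rfl⟩ := e.surjective t
  obtain ⟨r, hr⟩ := Submodule.mkQ_surjective _ (AdicCompletion.eval (maximalIdeal R) R n x)
  refine ⟨r, ?_⟩
  have hx : x - algebraMap R _ r ∈
      ((maximalIdeal R ^ n • ⊤ : Submodule R (AdicCompletion (maximalIdeal R) R))) := by
    rw [AdicCompletion.pow_smul_top_eq_ker_eval (IsNoetherian.noetherian _), LinearMap.mem_ker,
      map_sub, ← hr, sub_eq_zero]
    rfl
  rw [Ideal.smul_top_eq_map] at hx
  have h1 := Ideal.mem_map_of_mem e.toAlgHom.toRingHom hx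
  have h2 : e.toAlgHom.toRingHom.comp (algebraMap R _) = algebraMap R T :=
    e.toAlgHom.comp_algebraMap
  have h3 : e.toAlgHom.toRingHom (x - algebraMap R _ r) = e x - algebraMap R T r := by
    rw [map_sub, ← h2]
    rfl
  rw [← Ideal.map_pow, ← h2, ← Ideal.map_map, h2, ← h3]
  exact h1

end Completion

/-! ### Adjoining a generic element -/

section Transcendental

open Polynomial

variable {T : Type*} [CommRing T]

/-- The intersection of `T` with the fraction field of `R[u]`, for a subring `R` of `T` and an
element `u` of `T`: the elements `t` that satisfy `g(u) t = f(u)` for polynomials `f` and `g ≠ 0`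
over `R`. This encoding is adequate when `g(u)` is regular in `T` for all `g ≠ 0`. -/
def Subring.fractionsAdjoin (R : Subring T) [IsDomain R] (u : T) : Subring T where
  carrier := {t | ∃ f g : R[X], g ≠ 0 ∧ aeval u g * t = aeval u f}
  mul_mem' := by
    rintro a b ⟨f, g, hg, h⟩ ⟨f', g', hg', h'⟩
    refine ⟨f * f', g * g', mul_ne_zero hg hg', ?_⟩
    rw [map_mul, map_mul, ← h, ← h']
    ring
  one_mem' := ⟨1, 1, one_ne_zero, by simp⟩
  add_mem' := by
    rintro a b ⟨f, g, hg, h⟩ ⟨f', g', hg', h'⟩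
    refine ⟨f * g' + f' * g, g * g', mul_ne_zero hg hg', ?_⟩
    rw [map_mul, map_add, map_mul, map_mul, ← h, ← h']
    ring
  zero_mem' := ⟨0, 1, one_ne_zero, by simp⟩
  neg_mem' := by
    rintro a ⟨f, g, hg, h⟩
    exact ⟨-f, g, hg, by rw [map_neg, ← h, mul_neg]⟩

theorem Subring.mem_fractionsAdjoin_self (R : Subring T) [IsDomain R] (u : T) :
    u ∈ R.fractionsAdjoin u :=
  ⟨X, 1, one_ne_zero, by simp⟩

theorem Subring.le_fractionsAdjoin (R : Subring T) [IsDomain R] (u : T) :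
    R ≤ R.fractionsAdjoin u := fun r hr ↦
  ⟨C ⟨r, hr⟩, 1, one_ne_zero, by rw [map_one, one_mul, aeval_C]; rfl⟩

/-- If every nonzero polynomial over `R` takes at `u` a value that is a nonzero element of `R` times
a unit of `T`, then a fraction `f(u) / g(u)` lying in `T` is an element of `R` times a unit, because
divisibility of elements of `R` in `T` is divisibility in `R`. -/
theorem Subring.isUnitExtension_fractionsAdjoin (R : Subring T) [IsDomain R] (u : T)
    (hreg : ∀ r ∈ R, r ≠ 0 → IsRegular r)
    (hdvd : ∀ a ∈ R, ∀ b ∈ R, b ∣ a → ∃ c ∈ R, a = b * c)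
    (hu : ∀ f : R[X], f ≠ 0 → ∃ r : R, r ≠ 0 ∧ ∃ w : Tˣ, aeval u f = r * w) :
    R.IsUnitExtension (R.fractionsAdjoin u) := by
  refine ⟨R.le_fractionsAdjoin u, ?_⟩
  rintro t ⟨f, g, hg, h⟩
  have hC (r : R) : aeval u (C r) = (r : T) := aeval_C _ _
  obtain ⟨r₂, hr₂, w₂, e₂⟩ := hu g hg
  have hreg₂ : IsRegular (r₂ : T) := hreg _ r₂.2 (by simpa using hr₂)
  by_cases hf : f = 0
  · refine ⟨0, R.zero_mem, 1, Subring.one_mem _, 1, Subring.one_mem _, by simp, ?_⟩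
    have : (r₂ * w₂ : T) * t = (r₂ * w₂ : T) * 0 := by rw [← e₂, h, hf]; simp
    simpa using (hreg₂.mul w₂.isUnit.isRegular).left this
  obtain ⟨r₁, hr₁, w₁, e₁⟩ := hu f hf
  rw [e₁, e₂] at h
  have hw₁ : (w₁ : T) * (w₁⁻¹ : Tˣ) = 1 := w₁.mul_inv
  have hw₂ : (w₂ : T) * (w₂⁻¹ : Tˣ) = 1 := w₂.mul_inv
  obtain ⟨c, hc, hrc⟩ := hdvd r₁ r₁.2 r₂ r₂.2
    ⟨t * w₂ * (w₁⁻¹ : Tˣ), by linear_combination (- (w₁⁻¹ : Tˣ) : T) * h - r₁ * hw₁⟩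
  refine ⟨c, hc, w₁ * (w₂⁻¹ : Tˣ), ⟨C r₂ * f, C r₁ * g, mul_ne_zero (C_ne_zero.2 hr₁) hg, ?_⟩,
    w₂ * (w₁⁻¹ : Tˣ), ⟨C r₁ * g, C r₂ * f, mul_ne_zero (C_ne_zero.2 hr₂) hf, ?_⟩, ?_, ?_⟩
  · rw [map_mul, map_mul, hC, hC, e₁, e₂]
    linear_combination (r₁ * r₂ * w₁ : T) * hw₂
  · rw [map_mul, map_mul, hC, hC, e₁, e₂]
    linear_combination (r₁ * r₂ * w₂ : T) * hw₁
  · linear_combination (w₂ * (w₂⁻¹ : Tˣ) : T) * hw₁ + hw₂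
  · refine hreg₂.left ?_
    change (r₂ : T) * t = r₂ * (c * (w₁ * (w₂⁻¹ : Tˣ)))
    linear_combination ((w₂⁻¹ : Tˣ) : T) * h - (r₂ * t : T) * hw₂ + (w₁ * (w₂⁻¹ : Tˣ) : T) * hrc

/-- A ball `a + dR` contains a smaller ball `a' + d'R` on which `f` takes values in
`f(a') (1 + cR)`, with `f(a') ≠ 0`. -/
theorem exists_smaller_ball {R : Type*} [CommRing R] [IsDomain R] [Infinite R] {c : R} (hc : c ≠ 0)
    (f : R[X]) (hf : f ≠ 0) (a d : R) (hd : d ≠ 0) :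
    ∃ a' d' : R, d' ≠ 0 ∧ d ∣ a' - a ∧ c * d ∣ d' ∧ f.eval a' ≠ 0 ∧ c * f.eval a' ∣ d' := by
  -- the ball `a + dR` is infinite, so it is not contained in the root set of `f`
  obtain ⟨x, hx⟩ : ∃ x, f.eval (a + d * x) ≠ 0 := by
    by_contra! hall
    refine hf (f.eq_zero_of_infinite_isRoot (Set.Infinite.mono
      (s := Set.range fun x ↦ a + d * x) ?_ (Set.infinite_range_of_injective ?_)))
    · rintro _ ⟨x, rfl⟩
      exact hall x
    · intro x y hxy
      exact mul_left_cancel₀ hd (add_left_cancel hxy)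
  exact ⟨a + d * x, d * c * f.eval (a + d * x), mul_ne_zero (mul_ne_zero hd hc) hx, by simp,
    ⟨f.eval (a + d * x), by ring⟩, hx, ⟨d, by ring⟩⟩

/-- A ball `a + xT` is closed in the adic topology of a Noetherian local ring. -/
theorem dvd_of_forall_exists_dvd_sub [IsLocalRing T] [IsNoetherianRing T] (x y : T)
    (h : ∀ k : ℕ, ∃ z, x ∣ z ∧ y - z ∈ maximalIdeal T ^ k) : x ∣ y := by
  rw [← Ideal.mem_span_singleton, ← Ideal.Quotient.eq_zero_iff_mem]
  refine IsHausdorff.haus (inferInstance : IsHausdorff (maximalIdeal T) (T ⧸ Ideal.span {x})) _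
    fun k ↦ ?_
  obtain ⟨z, hxz, hz⟩ := h k
  rw [SModEq.zero]
  have hy : Ideal.Quotient.mk (Ideal.span {x}) y = (y - z) • (1 : T ⧸ Ideal.span {x}) := by
    rw [Algebra.smul_def, mul_one, Ideal.Quotient.algebraMap_eq, Ideal.Quotient.eq, sub_sub_cancel]
    exact Ideal.mem_span_singleton.2 hxz
  rw [hy]
  exact Submodule.smul_mem_smul hz trivial

theorem Polynomial.countable_of_countable (R : Type*) [CommRing R] [Countable R] :
    Countable R[X] := by
  rw [← Cardinal.mk_le_aleph0_iff]
  exact (Polynomial.cardinalMk_le_max).trans (by simp)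

/-- Over a countable subring `R` of a complete local ring, some limit `u` of elements of `R` is so
generic that each nonzero polynomial takes at `u` a value that is a nonzero element of `R` times
a unit. -/
theorem exists_generic [IsLocalRing T] [IsNoetherianRing T] [IsAdicComplete (maximalIdeal T) T]
    (R : Subring T) [IsDomain R] [Infinite R] [Countable R] (c : R) (hc : c ≠ 0)
    (hcM : (c : T) ∈ maximalIdeal T) :
    ∃ u : T, ∀ f : R[X], f ≠ 0 → ∃ r : R, r ≠ 0 ∧ ∃ w : Tˣ, aeval u f = r * w := by
  have := Polynomial.countable_of_countable R
  have : Nonempty {f : R[X] // f ≠ 0} := ⟨⟨1, one_ne_zero⟩⟩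
  obtain ⟨F, hF⟩ := exists_surjective_nat {f : R[X] // f ≠ 0}
  choose a' d' hd' haa hdd hfa hfd using fun (n : ℕ) (p : R × {d : R // d ≠ 0}) ↦
    exists_smaller_ball hc (F n).1 (F n).2 p.1 p.2.1 p.2.2
  let p : ℕ → R × {d : R // d ≠ 0} := fun n ↦
    Nat.rec (0, ⟨1, one_ne_zero⟩) (fun n q ↦ (a' n q, ⟨d' n q, hd' n q⟩)) n
  let a (n : ℕ) : R := (p n).1
  let d (n : ℕ) : R := (p n).2.1
  have ha (n : ℕ) : d n ∣ a (n + 1) - a n := haa n (p n)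
  have hd (n : ℕ) : c * d n ∣ d (n + 1) := hdd n (p n)
  have hfa (n : ℕ) : (F n).1.eval (a (n + 1)) ≠ 0 := hfa n (p n)
  have hfd (n : ℕ) : c * (F n).1.eval (a (n + 1)) ∣ d (n + 1) := hfd n (p n)
  have hdle {m n : ℕ} (hmn : m ≤ n) : d m ∣ d n := by
    induction n, hmn using Nat.le_induction with
    | base => rfl
    | succ n _ ih => exact ih.trans ((dvd_mul_left _ _).trans (hd n))
  have hale {m n : ℕ} (hmn : m ≤ n) : d m ∣ a n - a m := by
    induction n, hmn using Nat.le_induction with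
    | base => simp
    | succ n hmn ih =>
      have := dvd_add ((hdle hmn).trans (ha n)) ih
      rwa [sub_add_sub_cancel] at this
  have coe_dvd {x y : R} (h : x ∣ y) : (x : T) ∣ y := map_dvd R.subtype h
  have hdM (n : ℕ) : (d n : T) ∈ maximalIdeal T ^ n := by
    induction n with
    | zero => simp
    | succ n ih =>
      refine Ideal.mem_of_dvd _ (coe_dvd (hd n)) ?_
      rw [pow_succ', Subring.coe_mul]
      exact Ideal.mul_mem_mul hcM ih
  obtain ⟨u, hu⟩ := IsPrecomplete.prec
    (inferInstance : IsPrecomplete (maximalIdeal T) T) (f := fun n ↦ (a n : T)) (by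
      intro m n hmn
      rw [smul_eq_mul, Ideal.mul_top, SModEq.comm, SModEq.sub_mem]
      exact Ideal.mem_of_dvd _ (by simpa using coe_dvd (hale hmn)) (hdM m))
  have hua (n : ℕ) : (d n : T) ∣ u - a n := by
    refine dvd_of_forall_exists_dvd_sub _ _ fun k ↦ ⟨a (max n k) - a n, ?_, ?_⟩
    · simpa using coe_dvd (hale (le_max_left n k))
    · have := hu (max n k)
      rw [smul_eq_mul, Ideal.mul_top, SModEq.comm, SModEq.sub_mem] at this
      simpa using Ideal.pow_le_pow_right (le_max_right n k) this
  refine ⟨u, fun f hf ↦ ?_⟩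
  obtain ⟨n, hn⟩ := hF ⟨f, hf⟩
  have hfn : (F n).1 = f := congrArg Subtype.val hn
  set r := f.eval (a (n + 1)) with hr
  refine ⟨r, by simpa [hr, hfn] using hfa n, ?_⟩
  -- `f(u) - f(a (n + 1))` is divisible by `u - a (n + 1)`, hence by `c r`
  have h1 : aeval (a (n + 1) : T) f = (r : T) := by
    rw [hr]
    exact aeval_algebraMap_apply_eq_algebraMap_eval _ _
  have h2 : u - a (n + 1) ∣ aeval u f - r := by
    rw [← h1, aeval_def, aeval_def, ← eval_map, ← eval_map]
    exact sub_dvd_eval_sub _ _ _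
  have h3 : (c * r : T) ∣ d (n + 1) := by
    have := coe_dvd (hfd n)
    rwa [Subring.coe_mul, hfn] at this
  obtain ⟨t, ht⟩ := h3.trans ((hua (n + 1)).trans h2)
  have hunit : IsUnit (1 + c * t) := by
    by_contra hnon
    have h4 := (mem_maximalIdeal _).2 hnon
    rw [Ideal.add_mem_iff_left _ (Ideal.mul_mem_right _ _ hcM)] at h4
    exact (Ideal.ne_top_iff_one _).1 (maximalIdeal.isMaximal T).ne_top h4
  exact ⟨hunit.unit, by rw [IsUnit.unit_spec]; linear_combination ht⟩

end Transcendental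

/-! ### Uncountability of maximal unit extensions -/

section Uncountable

variable {T : Type*} [CommRing T]

theorem Subring.isDomain_of_isRegular [Nontrivial T] (B : Subring T)
    (h : ∀ b ∈ B, b ≠ 0 → IsRegular b) : IsDomain B :=
  have : NoZeroDivisors B := ⟨fun {a b} hab ↦ by
    by_contra! hne
    have h1 : (a : T) * b = a * 0 := by
      rw [mul_zero, ← Subring.coe_mul, hab, Subring.coe_zero]
    exact hne.2 (Subtype.ext ((h a a.2 (by simpa using hne.1)).left h1))⟩
  NoZeroDivisors.to_isDomain B

/-- A maximal unit extension is uncountable: over a countable one, adjoining a generic element and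
intersecting the fraction field with `T` gives a strictly larger unit extension. -/
theorem Subring.IsUnitExtension.uncountable_of_maximal [IsLocalRing T] [IsNoetherianRing T]
    [IsAdicComplete (maximalIdeal T) T] {S B : Subring T} (hB : Maximal S.IsUnitExtension B)
    (hreg : ∀ s ∈ S, s ≠ 0 → IsRegular s)
    (hdvd : ∀ a ∈ S, ∀ b ∈ S, b ∣ a → ∃ c ∈ S, a = b * c)
    {c : T} (hcS : c ∈ S) (hc : c ≠ 0) (hcM : c ∈ maximalIdeal T) : Uncountable B := by
  rw [← not_countable_iff]
  intro hcount
  have hSB := hB.prop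
  have hregB := hSB.isRegular hreg
  have hdom := B.isDomain_of_isRegular hregB
  have hcB : c ∈ B := hSB.le hcS
  have hc0 : (⟨c, hcB⟩ : B) ≠ 0 := fun h ↦ hc (congrArg Subtype.val h)
  have hinf : Infinite B := by
    -- a finite domain is a field, but `c` is a nonzero nonunit
    rw [← not_finite_iff_infinite]
    intro hfin
    obtain ⟨x, hx⟩ := (Finite.isField_of_domain B).mul_inv_cancel hc0
    exact (mem_maximalIdeal _).1 hcM (IsUnit.of_mul_eq_one (x : T) (congrArg Subtype.val hx))
  obtain ⟨u, hu⟩ := exists_generic B ⟨c, hcB⟩ hc0 hcM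
  have hext := B.isUnitExtension_fractionsAdjoin u hregB (hSB.exists_eq_mul_of_dvd hdvd) hu
  have huB : u ∈ B :=
    hB.le_of_ge (hSB.trans hext) (B.le_fractionsAdjoin u) (B.mem_fractionsAdjoin_self u)
  -- the polynomial `X - u` cannot take the value zero at `u`
  obtain ⟨r, hr, w, hw⟩ := hu (Polynomial.X - Polynomial.C ⟨u, huB⟩) (Polynomial.X_sub_C_ne_zero _)
  have hzero : Polynomial.aeval u (Polynomial.X - Polynomial.C (⟨u, huB⟩ : B)) = 0 := by
    rw [map_sub, Polynomial.aeval_X, Polynomial.aeval_C]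
    exact sub_self u
  rw [hzero, eq_comm, Units.mul_left_eq_zero] at hw
  exact hr (Subtype.ext hw)

end Uncountable

/-! ### Existence of an uncountable extension with the same ideals -/

theorem theorem3p6 {T : Type*} [CommRing T] [IsLocalRing T] [IsNoetherianRing T]
    [IsAdicComplete (maximalIdeal T) T] (hdim : 1 ≤ ringKrullDim T)
    (S : Subring T) [Countable S] [IsDomain S] [IsNoetherianRing S] [IsLocalRing S]
    (hSM : maximalIdeal S = (maximalIdeal T).comap S.subtype)
    (hST : IsCompletionOfLocalRing S T) :
    ∃ (B : Subring T) (hSB : S ≤ B) (_ : IsLocalRing B),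
      Uncountable B ∧ IsDomain B ∧ IsNoetherianRing B ∧
      maximalIdeal B = (maximalIdeal T).comap B.subtype ∧
      IsCompletionOfLocalRing B T ∧
      ∀ J : Ideal B, J.IsExtendedFrom hSB := by
  have hSloc : IsLocalHom S.subtype :=
    ((local_hom_TFAE S.subtype).out 0 4).2 hSM.symm
  have : IsLocalHom (algebraMap S T) := hSloc
  have hMmap := hST.maximalIdeal_eq_map
  have hflat : Module.Flat S T := hST.flat
  have hff : Module.FaithfullyFlat S T := .of_flat_of_isLocalHom
  have hreg : ∀ s ∈ S, s ≠ 0 → IsRegular s := by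
    intro s hs hs0
    have h1 : IsSMulRegular S (⟨s, hs⟩ : S) := fun x y hxy ↦
      mul_left_cancel₀ (fun h ↦ hs0 (congrArg Subtype.val h)) hxy
    have h2 : IsSMulRegular T (⟨s, hs⟩ : S) := h1.of_flat
    exact isLeftRegular_iff_isRegular.1 h2
  have hdvd : ∀ a ∈ S, ∀ b ∈ S, b ∣ a → ∃ c ∈ S, a = b * c := by
    intro a ha b hb hba
    have h1 : (⟨a, ha⟩ : S) ∈
        ((Ideal.span {(⟨b, hb⟩ : S)}).map (algebraMap S T)).comap (algebraMap S T) := by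
      rw [Ideal.mem_comap, Ideal.map_span, Set.image_singleton]
      exact Ideal.mem_span_singleton.2 hba
    rw [Ideal.comap_map_eq_self_of_faithfullyFlat] at h1
    obtain ⟨c, hc⟩ := Ideal.mem_span_singleton.1 h1
    exact ⟨c, c.2, congrArg Subtype.val hc⟩
  have hpow (n : ℕ) (s : S) : (s : T) ∈ maximalIdeal T ^ n ↔ s ∈ maximalIdeal S ^ n := by
    rw [← Ideal.comap_map_eq_self_of_faithfullyFlat (B := T) (maximalIdeal S ^ n), Ideal.map_pow,
      ← hMmap]
    rfl
  -- if `S` were a field, its completion `T` would be a field as well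
  obtain ⟨c, hcm, hc⟩ : ∃ c ∈ maximalIdeal S, c ≠ 0 := by
    rw [← Submodule.ne_bot_iff]
    intro hbot
    rw [hbot, Ideal.map_bot] at hMmap
    rw [ringKrullDim_eq_zero_of_isField (isField_iff_maximalIdeal_eq.2 hMmap)] at hdim
    exact absurd hdim (by norm_num)
  obtain ⟨B, hB⟩ := Subring.IsUnitExtension.exists_maximal S
  have hSB := hB.prop
  have hBloc : IsLocalHom B.subtype := hSB.isLocalHom_subtype hSloc
  have hBlocal : IsLocalRing B := B.subtype.domain_isLocalRing
  have hBM : maximalIdeal B = (maximalIdeal T).comap B.subtype := (maximalIdeal_comap _).symm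
  refine ⟨B, hSB.le, hBlocal, ?_, B.isDomain_of_isRegular (hSB.isRegular hreg),
    hSB.isNoetherianRing, hBM, ?_, hSB.isExtendedFrom⟩
  · refine Subring.IsUnitExtension.uncountable_of_maximal hB hreg hdvd c.2
      (fun h ↦ hc (Subtype.ext h)) ?_
    rw [hSM] at hcm
    exact hcm
  · refine isCompletionOfLocalRing_of_dense (maximalIdeal T) (fun n b ↦ ?_) fun n t ↦ ?_
    · rw [hBM]
      exact hSB.mem_pow_iff hpow n b
    · obtain ⟨s, hs⟩ := hST.dense n t
      exact ⟨⟨s, hSB.le s.2⟩, hs⟩
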